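/- **Setting.** Let $n\ge 1$. A density generator in dimension $m$ is a measurable $g:[0,\infty)\to[0,\infty)$ with $0<\int_0^\infty u^{m/2-1}g(u)\,du<\infty$; put $c_m(g)=\Gamma(m/2)\big/\big(\pi^{m/2}\int_0^\infty u^{m/2-1}g(u)\,du\big)$. The elliptical law $EC_m(\mu,\Sigma,g)$ has density $c_m(g)\,|\Sigma|^{-1/2}g\big((x-\mu)'\Sigma^{-1}(x-\mu)\big)$ on $\mathbb R^m$. Let $\mu,\alpha\in\mathbb R^n$, let $\Omega$ be a positive definite $n\times n$ matrix, and let $g=g^{(n+1)}$ be a density generator in dimension $n+1$. Put $\omega=\mathrm{diag}(\Omega)^{1/2}$, $q(x)=(x-\mu)'\Omega^{-1}(x-\mu)$, $g^{(n)}(u)=\int_0^\infty r^{-1/2}g(r+u)\,dr$ and $g_q(u)=g(u+q)/g^{(n)}(q)$. A random vector $Y$ in $\mathbb R^n$ satisfies $Y\sim SE_n(\mu,\Omega,\alpha,g)$ if it has the density $$x\mapsto 2\,f(x)\,F_{g_{q(x)}}\big(\alpha'\omega^{-1}(x-\mu)\big),$$ where $f$ is the density of $EC_n(\mu,\Omega,g^{(n)})$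 and $F_{g_q}$ is the distribution function of $EC_1(0,1,g_q)$. Put $\bar\Omega=\omega^{-1}\Omega\omega^{-1}$, $\delta=\bar\Omega\alpha/\sqrt{1+\alpha'\bar\Omega\alpha}$ (equivalently $\alpha=(1-\delta'\bar\Omega^{-1}\delta)^{-1/2}\,\bar\Omega^{-1}\delta$) and $\delta_w=\omega\delta$. Let $R_y$ be a random variable with density $$c_{n+1}(g)\,\frac{2\pi^{(n+1)/2}}{\Gamma((n+1)/2)}\,r^n g(r^2),\qquad r>0,$$ where $c_{n+1}(g)=1$ if $g$ is normalized, and let $R_x$ be chi distributed with $n+1$ degrees of freedom, i.e. the same with $g(u)=(2\pi)^{-(n+1)/2}e^{-u/2}$. Write $M_2=E(YY')$ and $M_4=E(Y\otimes Y'\otimes Y\otimes Y')=E(YY'\otimes YY')$, where $\otimes$ is the Kronecker product. **Corollary.** Let $Y\sim SE_n(\mu,\Omega,\alpha,g)$ and let $A$, $B$ be symmetric real $n\times n$ matrices. 1. If $E(R_y^2)<\infty$, then $M_2$ and $E(Y'AY)$ exist and $$E(Y'AY)=\mathrm{tr}(AM_2)=\mu'A\mu+2\sqrt{\tfrac{2}{\pi}}\,\frac{E(R_y)}{E(R_x)}\,\mu'A\delta_w+\frac{E(R_y^2)}{E(R_x^2)}\,\mathrm{tr}(A\Omega).$$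 2. If $E(R_y^4)<\infty$, then $M_4$ exists, $Y'AY$ and $Y'BY$ are square integrable, and $$E\big[(Y'AY)^2\big]=\mathrm{tr}\big((A\otimes A)M_4\big),$$ $$\mathrm{Var}(Y'AY)=\mathrm{tr}\big((A\otimes A)M_4\big)-\big(\mathrm{tr}(AM_2)\big)^2,$$ $$\mathrm{Cov}(Y'AY,Y'BY)=\mathrm{tr}\big((A\otimes B)M_4\big)-\mathrm{tr}(AM_2)\,\mathrm{tr}(BM_2).$$ -/

import Mathlib

open MeasureTheory ProbabilityTheory Matrix
open scoped Kronecker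

noncomputable section

namespace SkewElliptical

/-- `g` is a density generator in dimension `m`: a non-negative function on `[0, ∞)` with
`0 < ∫₀^∞ u^(m/2-1) g(u) du < ∞`. -/
structure IsDensityGenerator (m : ℕ) (g : ℝ → ℝ) : Prop where
  measurable : Measurable g
  nonneg : ∀ u, 0 ≤ u → 0 ≤ g u
  integrable : IntegrableOn (fun u : ℝ => u ^ ((m : ℝ) / 2 - 1) * g u) (Set.Ioi 0)
  pos : 0 < ∫ u in Set.Ioi (0 : ℝ), u ^ ((m : ℝ) / 2 - 1) * g u

/-- The normalizing constant `c_m` of the elliptical density with generator `g` in dimension `m`: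
`x ↦ c_m g(‖x‖²)` has total mass one on `ℝ^m`. -/
def normConst (m : ℕ) (g : ℝ → ℝ) : ℝ :=
  Real.Gamma ((m : ℝ) / 2) /
    (Real.pi ^ ((m : ℝ) / 2) * ∫ u in Set.Ioi (0 : ℝ), u ^ ((m : ℝ) / 2 - 1) * g u)

/-- The quadratic form `q(x) = (x - μ)' Σ⁻¹ (x - μ)`. -/
def mahalanobis {m : ℕ} (μ : Fin m → ℝ) (S : Matrix (Fin m) (Fin m) ℝ) (x : Fin m → ℝ) : ℝ :=
  (x - μ) ⬝ᵥ (S⁻¹ *ᵥ (x - μ))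

/-- The density of the elliptical law `EC_m(μ, Σ, g)`, namely `c_m |Σ|^(-1/2) g(q(x))`. -/
def ecDensity {m : ℕ} (μ : Fin m → ℝ) (S : Matrix (Fin m) (Fin m) ℝ) (g : ℝ → ℝ)
    (x : Fin m → ℝ) : ℝ :=
  normConst m g * (Real.sqrt S.det)⁻¹ * g (mahalanobis μ S x)

/-- The cumulative distribution function of the univariate law `EC_1(0, 1, g)`. -/
def ecCDF (g : ℝ → ℝ) (z : ℝ) : ℝ :=
  ∫ t in Set.Iic z, ecDensity (0 : Fin 1 → ℝ) 1 g (fun _ => t)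

/-- The marginal generator `g^(n)(u) = ∫₀^∞ r^(-1/2) g^(n+1)(r + u) dr`. -/
def marginalGen (g : ℝ → ℝ) (u : ℝ) : ℝ :=
  ∫ r in Set.Ioi (0 : ℝ), r ^ (-(1 / 2) : ℝ) * g (r + u)

/-- The conditional generator `g_q(u) = g^(n+1)(u + q) / g^(n)(q)`. -/
def condGen (g : ℝ → ℝ) (q u : ℝ) : ℝ :=
  g (u + q) / marginalGen g q

/-- The diagonal matrix `ω = diag(Ω)^(1/2)`. -/
def scaleMatrix {n : ℕ} (Ω : Matrix (Fin n) (Fin n) ℝ) : Matrix (Fin n) (Fin n) ℝ :=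
  Matrix.diagonal fun i => Real.sqrt (Ω i i)

/-- The density of `SE_n(μ, Ω, α, g^(n+1))` at `x`:
`2 f(x; μ, Ω) F(α' ω⁻¹ (x - μ))`, where `f` is the density of `EC_n(μ, Ω, g^(n))` and `F` is the
distribution function of `EC_1(0, 1, g_{q(x)})`. -/
def seDensity {n : ℕ} (μ : Fin n → ℝ) (Ω : Matrix (Fin n) (Fin n) ℝ) (α : Fin n → ℝ)
    (g : ℝ → ℝ) (x : Fin n → ℝ) : ℝ :=
  2 * ecDensity μ Ω (marginalGen g) x *
    ecCDF (condGen g (mahalanobis μ Ω x)) (α ⬝ᵥ ((scaleMatrix Ω)⁻¹ *ᵥ (x - μ)))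

/-- `Y ∼ SE_n(μ, Ω, α, g^(n+1))` under `P`. -/
structure IsSkewElliptical {S : Type*} [MeasurableSpace S] {n : ℕ} (Y : S → Fin n → ℝ)
    (μ : Fin n → ℝ) (Ω : Matrix (Fin n) (Fin n) ℝ) (α : Fin n → ℝ) (g : ℝ → ℝ)
    (P : Measure S) : Prop where
  posDef : Ω.PosDef
  generator : IsDensityGenerator (n + 1) g
  hasLaw : HasLaw Y
    ((volume : Measure (Fin n → ℝ)).withDensity fun x => ENNReal.ofReal (seDensity μ Ω α g x)) P

/-- The scaled dispersion matrix `Ω̄ = ω⁻¹ Ω ω⁻¹`. -/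
def corrMatrix {n : ℕ} (Ω : Matrix (Fin n) (Fin n) ℝ) : Matrix (Fin n) (Fin n) ℝ :=
  (scaleMatrix Ω)⁻¹ * Ω * (scaleMatrix Ω)⁻¹

/-- The vector `δ` attached to `(Ω, α)`: the solution `δ = Ω̄ α / √(1 + α' Ω̄ α)` of
`α = Ω̄⁻¹ δ (1 - δ' Ω̄⁻¹ δ)^(-1/2)`. -/
def skewDelta {n : ℕ} (Ω : Matrix (Fin n) (Fin n) ℝ) (α : Fin n → ℝ) : Fin n → ℝ :=
  (Real.sqrt (1 + α ⬝ᵥ (corrMatrix Ω *ᵥ α)))⁻¹ • (corrMatrix Ω *ᵥ α)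

/-- The vector `δ_w = ω δ`. -/
def skewDeltaW {n : ℕ} (Ω : Matrix (Fin n) (Fin n) ℝ) (α : Fin n → ℝ) : Fin n → ℝ :=
  scaleMatrix Ω *ᵥ skewDelta Ω α

/-- The law of the radial variable `R = ‖Z‖` of a spherical vector `Z` in `ℝ^(n+1)` with density
generator `g`: it has density `c_{n+1} (2 π^((n+1)/2) / Γ((n+1)/2)) r^n g(r²)` on `r > 0`
(and `c_{n+1} = 1` if `g` is normalized). -/
def radialLaw (n : ℕ) (g : ℝ → ℝ) : Measure ℝ :=
  (volume.restrict (Set.Ioi 0)).withDensity fun r =>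
    ENNReal.ofReal (normConst (n + 1) g *
      (2 * Real.pi ^ (((n : ℝ) + 1) / 2) / Real.Gamma (((n : ℝ) + 1) / 2)) * r ^ n * g (r ^ 2))

/-- The normal density generator `(2π)^(-m/2) exp(-u/2)` in dimension `m`. -/
def normalGen (m : ℕ) (u : ℝ) : ℝ :=
  (2 * Real.pi) ^ (-((m : ℝ) / 2)) * Real.exp (-u / 2)

/-- The quadratic form `y' A y`. -/
def quadForm {n : ℕ} (A : Matrix (Fin n) (Fin n) ℝ) (y : Fin n → ℝ) : ℝ :=
  y ⬝ᵥ (A *ᵥ y)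

/-- The second moment matrix `M₂ = E(Y Y')`, with entrywise expectation. -/
def M2 {S : Type*} [MeasurableSpace S] {n : ℕ} (Y : S → Fin n → ℝ) (P : Measure S) :
    Matrix (Fin n) (Fin n) ℝ :=
  Matrix.of fun i j => ∫ s, vecMulVec (Y s) (Y s) i j ∂P

/-- The fourth moment matrix `M₄ = E(Y ⊗ Y' ⊗ Y ⊗ Y') = E(Y Y' ⊗ Y Y')`, with entrywise
expectation. -/
def M4 {S : Type*} [MeasurableSpace S] {n : ℕ} (Y : S → Fin n → ℝ) (P : Measure S) :
    Matrix (Fin n × Fin n) (Fin n × Fin n) ℝ :=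
  Matrix.of fun p q => ∫ s, (vecMulVec (Y s) (Y s) ⊗ₖ vecMulVec (Y s) (Y s)) p q ∂P

end SkewElliptical

end

/-! Write Ω = L L' and split a point of ℝ^(n+1) as w = (t, u). At x = μ + L u one has q(x) = |u|²,
and g^(n)(q) F_{g_q}(z) is the integral of g(t² + q) over t ≤ z. So the skew-elliptical density is,
up to a constant, the integral over t of the spherical density g(|w|²) restricted to t ≤ α'ω⁻¹L u.
This is a half space through the origin with inner normal b = (-1, L'ω⁻¹α), and Y is distributed as
μ + L u under the normalized restriction (`IsSkewElliptical.exists_map_eq`).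

An even function has half of its full integral over a half space (`setIntegral_halfSpace_of_even`),
so the quadratic part of YY' sees no skewness and contributes a multiple of Ω. For the linear part,
reflections remove everything orthogonal to b (`setIntegral_halfSpace_inner`), and what remains
along b is δ_w up to a scalar.

The scalars come from polar coordinates: the integral of a homogeneous function of degree d is a
sphere integral independent of g times a radial moment. Comparison with the normal generator yields
E(R_y^d)/E(R_x^d) times the Gaussian value, which is √(2/π) for d = 1 and 1 for d = 2
(`integral_genMeasure_eq_ratio`). Normalizing constants are never evaluated; total mass one
determines them.

The fourth-order statements need only integrability and the linearity of the trace
(`integral_quadForm_mul_quadForm`). -/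

noncomputable section

namespace SkewElliptical

/-! ### Rotation invariant measures: polar coordinates, symmetries and half-space integrals. -/

section Spherical

open scoped RealInnerProductSpace

variable {E : Type*} [NormedAddCommGroup E] [InnerProductSpace ℝ E] [FiniteDimensional ℝ E]
  [MeasurableSpace E] [BorelSpace E]

/-- Polar integration of a positively homogeneous function of degree `d` against a radial weight. -/
theorem integral_homogeneous_mul_radial [Nontrivial E] {d : ℕ} {k : E → ℝ}
    (hk : ∀ r : ℝ, 0 < r → ∀ w, k (r • w) = r ^ d * k w) (f : ℝ → ℝ) :
    ∫ w, k w * f ‖w‖ = (∫ θ, k θ.1 ∂(volume : Measure E).toSphere) *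
      ∫ r in Set.Ioi (0 : ℝ), r ^ (Module.finrank ℝ E - 1) * (r ^ d * f r) := by
  calc
    ∫ w, k w * f ‖w‖ = ∫ x : ({(0)}ᶜ : Set E), k x.1 * f ‖x.1‖ ∂(volume.comap Subtype.val) := by
      rw [integral_subtype_comap (measurableSet_singleton _).compl fun x ↦ k x * f (‖x‖),
        restrict_compl_singleton]
    _ = ∫ x : Metric.sphere (0 : E) 1 × Set.Ioi (0 : ℝ), k x.1.1 * (x.2.1 ^ d * f x.2.1)
          ∂(volume : Measure E).toSphere.prod (.volumeIoiPow (Module.finrank ℝ E - 1)) := by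
      rw [← (volume : Measure E).measurePreserving_homeomorphUnitSphereProd.integral_comp
        (Homeomorph.measurableEmbedding _)]
      refine integral_congr_ae (.of_forall fun x => ?_)
      have hx : 0 < ‖x.1‖ := norm_pos_iff.2 x.2
      have : k x.1 = ‖x.1‖ ^ d * k (‖x.1‖⁻¹ • x.1) := by
        rw [← hk _ hx, smul_smul, mul_inv_cancel₀ hx.ne', one_smul]
      simp only [homeomorphUnitSphereProd_apply_snd_coe, homeomorphUnitSphereProd_apply_fst_coe]
      rw [this]; ring
    _ = (∫ θ, k θ.1 ∂(volume : Measure E).toSphere) *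
          ∫ r : Set.Ioi (0 : ℝ), r.1 ^ d * f r ∂.volumeIoiPow (Module.finrank ℝ E - 1) :=
      -- This identity holds without integrability of either factor, so none is assumed on `k` or
      -- `f`.
      integral_prod_mul (fun θ : Metric.sphere (0 : E) 1 => k θ.1)
        (fun r : Set.Ioi (0 : ℝ) => r.1 ^ d * f r)
    _ = _ := by
      congr 1
      simp only [Measure.volumeIoiPow, ENNReal.ofReal]
      rw [integral_withDensity_eq_integral_smul,
        integral_subtype_comap measurableSet_Ioi fun a ↦
          Real.toNNReal (a ^ (Module.finrank ℝ E - 1)) • (a ^ d * f a),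
        setIntegral_congr_fun measurableSet_Ioi fun x hx ↦ ?_]
      · rw [NNReal.smul_def, Real.coe_toNNReal _ (pow_nonneg hx.out.le _), smul_eq_mul]
      · exact (measurable_subtype_coe.pow_const _).real_toNNReal

/-- The rotation invariant measure with density `w ↦ f ‖w‖`. -/
def sphericalMeasure (E : Type*) [NormedAddCommGroup E] [InnerProductSpace ℝ E]
    [FiniteDimensional ℝ E] [MeasurableSpace E] [BorelSpace E] (f : ℝ → ℝ) : Measure E :=
  volume.withDensity fun w => ENNReal.ofReal (f ‖w‖)

variable {f : ℝ → ℝ}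

theorem measurePreserving_sphericalMeasure (hf : Measurable f) (e : E ≃ₗᵢ[ℝ] E) :
    MeasurePreserving e (sphericalMeasure E f) (sphericalMeasure E f) := by
  refine ⟨e.continuous.measurable, Measure.ext fun s hs => ?_⟩
  have he : MeasurePreserving e volume volume := e.measurePreserving
  rw [Measure.map_apply e.continuous.measurable hs, sphericalMeasure,
    withDensity_apply _ (e.continuous.measurable hs), withDensity_apply _ hs,
    ← he.setLIntegral_comp_preimage hs (by fun_prop)]
  simp

theorem integral_comp_sphericalMeasure (hf : Measurable f) (e : E ≃ₗᵢ[ℝ] E) (k : E → ℝ) :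
    ∫ w, k (e w) ∂sphericalMeasure E f = ∫ w, k w ∂sphericalMeasure E f :=
  (measurePreserving_sphericalMeasure hf e).integral_comp
    e.toHomeomorph.measurableEmbedding k

theorem integral_sphericalMeasure (hf : Measurable f) (hf0 : ∀ r, 0 ≤ r → 0 ≤ f r) (k : E → ℝ) :
    ∫ w, k w ∂sphericalMeasure E f = ∫ w, k w * f ‖w‖ := by
  rw [sphericalMeasure, integral_withDensity_eq_integral_toReal_smul (by fun_prop) (by simp)]
  refine integral_congr_ae (.of_forall fun w => ?_)
  simp [ENNReal.toReal_ofReal (hf0 _ (norm_nonneg w)), mul_comm]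

theorem integrable_norm_pow_sphericalMeasure [Nontrivial E] (hf : Measurable f)
    (hf0 : ∀ r, 0 ≤ r → 0 ≤ f r) (d : ℕ)
    (h : IntegrableOn (fun r => r ^ (Module.finrank ℝ E - 1) * (r ^ d * f r)) (Set.Ioi 0)) :
    Integrable (fun w => ‖w‖ ^ d) (sphericalMeasure E f) := by
  rw [sphericalMeasure, integrable_withDensity_iff_integrable_smul' (by fun_prop) (by simp)]
  refine ((integrable_fun_norm_addHaar (volume : Measure E)
    (f := fun r => r ^ d * f r)).2 (by simpa using h)).congr (.of_forall fun w => ?_)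
  simp [ENNReal.toReal_ofReal (hf0 _ (norm_nonneg w)), mul_comm]

/-- The vectors ‖b‖ e₀ and b have equal norm, so a reflection carries one to the other. Invariance
of the measure replaces b by ‖b‖ e₀, and homogeneity extracts ‖b‖^d; allowing r = 0 in `hk` covers b
= 0. -/
theorem integral_inner_eq_of_homogeneous (hf : Measurable f) {d : ℕ} {k : ℝ → ℝ}
    (hk : ∀ r : ℝ, 0 ≤ r → ∀ x, k (r * x) = r ^ d * k x) (b : E) {e₀ : E} (he₀ : ‖e₀‖ = 1) :
    ∫ w, k ⟪b, w⟫ ∂sphericalMeasure E f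
      = ‖b‖ ^ d * ∫ w, k ⟪e₀, w⟫ ∂sphericalMeasure E f := by
  obtain ⟨e, he⟩ : ∃ e : E ≃ₗᵢ[ℝ] E, e (‖b‖ • e₀) = b :=
    ⟨_, Submodule.reflection_sub (by simp [norm_smul, he₀])⟩
  rw [← integral_comp_sphericalMeasure hf e, ← integral_const_mul]
  refine integral_congr_ae (.of_forall fun w => ?_)
  simp only
  have hinner : ⟪b, e w⟫ = ‖b‖ * ⟪e₀, w⟫ := by
    rw [← real_inner_smul_left, ← e.inner_map_map (‖b‖ • e₀), he]
  rw [hinner, hk _ (norm_nonneg b)]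

theorem integral_abs_inner_sphericalMeasure (hf : Measurable f) (b : E) {e₀ : E}
    (he₀ : ‖e₀‖ = 1) :
    ∫ w, |⟪b, w⟫| ∂sphericalMeasure E f = ‖b‖ * ∫ w, |⟪e₀, w⟫| ∂sphericalMeasure E f := by
  simpa using integral_inner_eq_of_homogeneous hf (d := 1) (k := fun x => |x|)
    (fun r hr x => by rw [abs_mul, abs_of_nonneg hr, pow_one]) b he₀

theorem integral_inner_sq_sphericalMeasure (hf : Measurable f) (b : E) {e₀ : E}
    (he₀ : ‖e₀‖ = 1) :
    ∫ w, ⟪b, w⟫ ^ 2 ∂sphericalMeasure E f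
      = ‖b‖ ^ 2 * ∫ w, ⟪e₀, w⟫ ^ 2 ∂sphericalMeasure E f :=
  integral_inner_eq_of_homogeneous hf (d := 2) (k := fun x => x ^ 2)
    (fun r _ x => by ring) b he₀

theorem integrable_inner_mul_inner {m : Measure E} (h : Integrable (fun w => ‖w‖ ^ 2) m)
    (a b : E) : Integrable (fun w => ⟪a, w⟫ * ⟪b, w⟫) m := by
  refine (h.const_mul (‖a‖ * ‖b‖)).mono' (by fun_prop) (.of_forall fun w => ?_)
  rw [norm_mul]
  calc _ ≤ (‖a‖ * ‖w‖) * (‖b‖ * ‖w‖) :=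
        mul_le_mul (norm_inner_le_norm _ _) (norm_inner_le_norm _ _) (norm_nonneg _) (by positivity)
    _ = _ := by ring

theorem integrable_inner_of_norm {m : Measure E} (h : Integrable (fun w => ‖w‖) m)
    (a : E) : Integrable (fun w => ⟪a, w⟫) m :=
  (h.const_mul ‖a‖).mono' (by fun_prop) (.of_forall fun w => norm_inner_le_norm _ _)

/-- Polarization of `integral_inner_sq_sphericalMeasure`. -/
theorem integral_inner_mul_inner_sphericalMeasure (hf : Measurable f)
    (h : Integrable (fun w => ‖w‖ ^ 2) (sphericalMeasure E f)) (a b : E) {e₀ : E}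
    (he₀ : ‖e₀‖ = 1) :
    ∫ w, ⟪a, w⟫ * ⟪b, w⟫ ∂sphericalMeasure E f
      = ⟪a, b⟫ * ∫ w, ⟪e₀, w⟫ ^ 2 ∂sphericalMeasure E f := by
  have h1 := integral_inner_sq_sphericalMeasure hf (a + b) he₀
  have h2 := integral_inner_sq_sphericalMeasure hf (a - b) he₀
  have hi : ∀ c : E, Integrable (fun w => ⟪c, w⟫ ^ 2) (sphericalMeasure E f) := fun c => by
    simpa [sq] using integrable_inner_mul_inner h c c
  have h3 : ∫ w, ⟪a, w⟫ * ⟪b, w⟫ ∂sphericalMeasure E f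
      = (1 / 4) * (∫ w, ⟪a + b, w⟫ ^ 2 ∂sphericalMeasure E f
        - ∫ w, ⟪a - b, w⟫ ^ 2 ∂sphericalMeasure E f) := by
    rw [← integral_sub (hi _) (hi _), ← integral_const_mul]
    refine integral_congr_ae (.of_forall fun w => ?_)
    simp only [inner_add_left, inner_sub_left]
    ring
  rw [h3, h1, h2, norm_add_sq_real, norm_sub_sq_real]
  ring

/-- The closed half space with inner normal `b`. -/
def halfSpace (b : E) : Set E := {w | 0 ≤ ⟪b, w⟫}

omit [FiniteDimensional ℝ E] in
theorem measurableSet_halfSpace (b : E) : MeasurableSet (halfSpace b) :=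
  (isClosed_le continuous_const (by fun_prop)).measurableSet

/-- Needed so that the complement of a half space agrees almost everywhere with its image under w ↦
-w. -/
theorem sphericalMeasure_hyperplane {b : E} (hb : b ≠ 0) :
    sphericalMeasure E f {w | ⟪b, w⟫ = 0} = 0 := by
  refine withDensity_absolutelyContinuous _ _ ?_
  have : {w | ⟪b, w⟫ = 0} = (((ℝ ∙ b)ᗮ : Submodule ℝ E) : Set E) := by
    ext w; simp [Submodule.mem_orthogonal_singleton_iff_inner_right]
  rw [this]
  refine Measure.addHaar_submodule _ _ fun htop => hb ?_
  have : b ∈ (ℝ ∙ b)ᗮ := htop ▸ Submodule.mem_top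
  simpa [Submodule.mem_orthogonal_singleton_iff_inner_right] using this

/-- An even function has half of its integral over a half space. -/
theorem setIntegral_halfSpace_of_even (hf : Measurable f) {b : E} (hb : b ≠ 0) {k : E → ℝ}
    (hk : Integrable k (sphericalMeasure E f)) (heven : ∀ w, k (-w) = k w) :
    ∫ w in halfSpace b, k w ∂sphericalMeasure E f = (∫ w, k w ∂sphericalMeasure E f) / 2 := by
  have hcompl : ∫ w in (halfSpace b)ᶜ, k w ∂sphericalMeasure E f
      = ∫ w in halfSpace b, k w ∂sphericalMeasure E f := by
    have hneg := (measurePreserving_sphericalMeasure (E := E) hf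
      (LinearIsometryEquiv.neg ℝ)).setIntegral_preimage_emb
      (LinearIsometryEquiv.neg ℝ).toHomeomorph.measurableEmbedding k (halfSpace b)
    rw [← hneg]
    have hset : ((halfSpace b)ᶜ : Set E) =ᵐ[sphericalMeasure E f]
        (⇑(LinearIsometryEquiv.neg ℝ (E := E)) ⁻¹' halfSpace b : Set E) := by
      have h0 : ∀ᵐ w ∂sphericalMeasure E f, ⟪b, w⟫ ≠ 0 := by
        rw [ae_iff]; simpa using sphericalMeasure_hyperplane hb
      filter_upwards [h0] with w hw
      refine propext ?_
      change (¬ (0 ≤ ⟪b, w⟫)) ↔ 0 ≤ ⟪b, -w⟫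
      rw [inner_neg_right, not_le]
      exact ⟨fun h => by linarith, fun h => lt_of_le_of_ne (by linarith) hw⟩
    rw [setIntegral_congr_set hset]
    simp [heven]
  have := integral_add_compl (measurableSet_halfSpace b) hk
  linarith

/-- The reflection in the hyperplane orthogonal to v fixes b, hence preserves the half space, and
changes the sign of the integrand. -/
theorem setIntegral_halfSpace_inner_of_orthogonal (hf : Measurable f) {b v : E}
    (hbv : ⟪v, b⟫ = 0) :
    ∫ w in halfSpace b, ⟪v, w⟫ ∂sphericalMeasure E f = 0 := by
  set e : E ≃ₗᵢ[ℝ] E := (ℝ ∙ v)ᗮ.reflection with he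
  have hev : e v = -v := Submodule.reflection_orthogonalComplement_singleton_eq_neg v
  have heb : e b = b := Submodule.reflection_mem_subspace_eq_self
    (Submodule.mem_orthogonal_singleton_iff_inner_right.2 hbv)
  have h := (measurePreserving_sphericalMeasure hf e).setIntegral_preimage_emb
    e.toHomeomorph.measurableEmbedding (fun w => ⟪v, w⟫) (halfSpace b)
  have hset : e ⁻¹' halfSpace b = halfSpace b := by
    ext w
    change 0 ≤ ⟪b, e w⟫ ↔ 0 ≤ ⟪b, w⟫
    conv_lhs => rw [← heb, e.inner_map_map]
  have hin : ∀ w, ⟪v, e w⟫ = -⟪v, w⟫ := fun w => by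
    rw [← neg_neg v, ← hev, inner_neg_left, e.inner_map_map, hev, neg_neg]
  simp only [hset, hin, integral_neg] at h
  linarith

/-- The first moment of a rotation invariant measure over a half space. -/
theorem setIntegral_halfSpace_inner (hf : Measurable f)
    (h : Integrable (fun w => ‖w‖) (sphericalMeasure E f)) {b : E} (hb : b ≠ 0) (v : E) {e₀ : E}
    (he₀ : ‖e₀‖ = 1) :
    ∫ w in halfSpace b, ⟪v, w⟫ ∂sphericalMeasure E f
      = ⟪v, b⟫ / ‖b‖ * (∫ w, |⟪e₀, w⟫| ∂sphericalMeasure E f) / 2 := by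
  have hb' : ‖b‖ ≠ 0 := norm_ne_zero_iff.2 hb
  -- The component of v along b is c b. The orthogonal rest integrates to zero, and on the half
  -- space ⟪b, w⟫ equals the even function |⟪b, w⟫|.
  set c := ⟪v, b⟫ / ‖b‖ ^ 2 with hc
  have horth : ⟪v - c • b, b⟫ = 0 := by
    rw [inner_sub_left, real_inner_smul_left, real_inner_self_eq_norm_sq, hc]
    field_simp
    ring
  have hbb : ∫ w in halfSpace b, ⟪b, w⟫ ∂sphericalMeasure E f
      = (‖b‖ * ∫ w, |⟪e₀, w⟫| ∂sphericalMeasure E f) / 2 := by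
    rw [← integral_abs_inner_sphericalMeasure hf b he₀, ← setIntegral_halfSpace_of_even hf hb
      (integrable_inner_of_norm h b).abs (by simp)]
    exact setIntegral_congr_fun (measurableSet_halfSpace b) fun w hw => (abs_of_nonneg hw).symm
  have hsplit : ∀ w, ⟪v, w⟫ = ⟪v - c • b, w⟫ + c * ⟪b, w⟫ := fun w => by
    rw [inner_sub_left, real_inner_smul_left]; ring
  rw [show (fun w => ⟪v, w⟫) = fun w => ⟪v - c • b, w⟫ + c * ⟪b, w⟫ from funext hsplit,
    integral_add (integrable_inner_of_norm h _).integrableOn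
    ((integrable_inner_of_norm h b).const_mul c).integrableOn, integral_const_mul,
    setIntegral_halfSpace_inner_of_orthogonal hf horth, hbb, hc]
  field_simp
  ring

end Spherical

/-! ### Radial moments and the Gaussian reference values. -/

section Moments

open scoped RealInnerProductSpace

/-- The unnormalized `d`-th moment of the radial part in dimension `n + 1`. -/
def radialMoment (n : ℕ) (g : ℝ → ℝ) (d : ℕ) : ℝ :=
  ∫ r in Set.Ioi (0 : ℝ), r ^ n * (r ^ d * g (r ^ 2))

/-- The spherical measure on `ℝ^(n+1)` with generator `g`, not normalized. -/
abbrev genMeasure (n : ℕ) (g : ℝ → ℝ) : Measure (EuclideanSpace ℝ (Fin (n + 1))) :=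
  sphericalMeasure (EuclideanSpace ℝ (Fin (n + 1))) fun r => g (r ^ 2)

/-- The first coordinate vector. -/
abbrev firstAxis (n : ℕ) : EuclideanSpace ℝ (Fin (n + 1)) := EuclideanSpace.single 0 1

theorem norm_firstAxis (n : ℕ) : ‖firstAxis n‖ = 1 := by simp

theorem inner_firstAxis {n : ℕ} (w : EuclideanSpace ℝ (Fin (n + 1))) :
    ⟪firstAxis n, w⟫ = w 0 := by
  simp [EuclideanSpace.inner_single_left]

/-- The sphere integral does not involve g, which makes different generators comparable. -/
theorem integral_genMeasure_of_homogeneous {n : ℕ} {g : ℝ → ℝ}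
    (hg : Measurable g) (hg0 : ∀ u, 0 ≤ u → 0 ≤ g u) {d : ℕ}
    {k : EuclideanSpace ℝ (Fin (n + 1)) → ℝ}
    (hk : ∀ r : ℝ, 0 < r → ∀ w, k (r • w) = r ^ d * k w) :
    ∫ w, k w ∂genMeasure n g
      = (∫ θ, k θ.1 ∂(volume : Measure (EuclideanSpace ℝ (Fin (n + 1)))).toSphere)
        * radialMoment n g d := by
  rw [genMeasure, integral_sphericalMeasure (by fun_prop) (fun r _ => hg0 _ (sq_nonneg r)),
    integral_homogeneous_mul_radial hk (fun r => g (r ^ 2))]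
  simp [radialMoment]

theorem integral_exp_neg_half_sq : ∫ x : ℝ, Real.exp (-x ^ 2 / 2) = √(2 * Real.pi) := by
  have := integral_gaussian (1 / 2)
  rw [show Real.pi / (1 / 2) = 2 * Real.pi by ring] at this
  rw [← this]
  congr 1; ext x; congr 1; ring

theorem integral_abs_mul_exp_neg_half_sq : ∫ x : ℝ, |x| * Real.exp (-x ^ 2 / 2) = 2 := by
  have h1 := integral_comp_abs (f := fun x => x * Real.exp (-x ^ 2 / 2))
  have h2 := integral_rpow_mul_exp_neg_mul_rpow (p := 2) (q := 1) (b := 1 / 2) (by norm_num)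
    (by norm_num) (by norm_num)
  simp only [sq_abs] at h1
  rw [h1]
  have h3 : ∫ x in Set.Ioi (0 : ℝ), x * Real.exp (-x ^ 2 / 2) = 1 := by
    calc _ = ∫ x in Set.Ioi (0 : ℝ), x ^ (1 : ℝ) * Real.exp (-(1 / 2) * x ^ (2 : ℝ)) := by
          refine setIntegral_congr_fun measurableSet_Ioi fun x _ => ?_
          simp only [Real.rpow_one, Real.rpow_two]
          congr 2; ring
      _ = 1 := by
          rw [h2]
          norm_num [Real.rpow_neg_one]
  rw [h3]; norm_num

theorem integral_sq_mul_exp_neg_half_sq :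
    ∫ x : ℝ, x ^ 2 * Real.exp (-x ^ 2 / 2) = √(2 * Real.pi) := by
  have h1 := integral_comp_abs (f := fun x => x ^ 2 * Real.exp (-x ^ 2 / 2))
  have h2 := integral_rpow_mul_exp_neg_mul_rpow (p := 2) (q := 2) (b := 1 / 2) (by norm_num)
    (by norm_num) (by norm_num)
  simp only [sq_abs] at h1
  rw [h1]
  have h3 : ∫ x in Set.Ioi (0 : ℝ), x ^ 2 * Real.exp (-x ^ 2 / 2)
      = ∫ x in Set.Ioi (0 : ℝ), x ^ (2 : ℝ) * Real.exp (-(1 / 2) * x ^ (2 : ℝ)) := by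
    refine setIntegral_congr_fun measurableSet_Ioi fun x _ => ?_
    simp only [Real.rpow_two]
    congr 2; ring
  rw [h3, h2, show ((2 : ℝ) + 1) / 2 = 1 / 2 + 1 by norm_num, Real.Gamma_add_one (by norm_num),
    Real.Gamma_one_half_eq, show -((2 : ℝ) + 1) / 2 = -1 - 1 / 2 by norm_num,
    Real.rpow_sub (by norm_num), Real.rpow_neg_one, ← Real.sqrt_eq_rpow, Real.sqrt_mul (by norm_num)]
  rw [one_div, Real.sqrt_inv]
  field_simp

/-- The normal generator factors over the coordinates. The remaining constant is left as it is,
since it cancels against the case φ = 1. -/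
theorem integral_normalGen_fun_fst (n : ℕ) (φ : ℝ → ℝ) :
    ∫ w : EuclideanSpace ℝ (Fin (n + 1)), φ (w 0) * normalGen (n + 1) (‖w‖ ^ 2)
      = (∫ x : ℝ, φ x * Real.exp (-x ^ 2 / 2))
        * ((2 * Real.pi) ^ (-(((n + 1 : ℕ) : ℝ) / 2)) * √(2 * Real.pi) ^ n) := by
  rw [← (PiLp.volume_preserving_toLp (Fin (n + 1))).integral_comp
    (MeasurableEquiv.toLp 2 (Fin (n + 1) → ℝ)).measurableEmbedding]
  have hprod : ∀ x : Fin (n + 1) → ℝ,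
      φ ((WithLp.toLp 2 x) 0) * normalGen (n + 1) (‖WithLp.toLp 2 x‖ ^ 2)
        = (2 * Real.pi) ^ (-(((n + 1 : ℕ) : ℝ) / 2)) * ∏ i, (Fin.cons (fun y => φ y * Real.exp (-y ^ 2 / 2))
          (fun _ y => Real.exp (-y ^ 2 / 2)) : Fin (n + 1) → ℝ → ℝ) i (x i) := fun x => by
    rw [EuclideanSpace.norm_sq_eq, Fin.prod_univ_succ, Fin.sum_univ_succ, normalGen]
    simp only [Fin.cons_zero, Fin.cons_succ, Real.norm_eq_abs, sq_abs]
    rw [← Real.exp_sum, mul_assoc, ← Real.exp_add, mul_left_comm, ← Finset.sum_div,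
      Finset.sum_neg_distrib, ← add_div, neg_add]
  simp_rw [hprod]
  rw [integral_const_mul, integral_fintype_prod_volume_eq_prod, Fin.prod_univ_succ]
  simp only [Fin.cons_zero, Fin.cons_succ, integral_exp_neg_half_sq, Finset.prod_const,
    Finset.card_univ, Fintype.card_fin]
  ring

theorem measurable_normalGen (m : ℕ) : Measurable (normalGen m) := by
  unfold normalGen; fun_prop

theorem normalGen_nonneg (m : ℕ) (u : ℝ) : 0 ≤ normalGen m u := by
  unfold normalGen; positivity

theorem integral_normal_fun_fst (n : ℕ) (φ : ℝ → ℝ) :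
    ∫ w, φ (w 0) ∂genMeasure n (normalGen (n + 1))
      = (∫ x : ℝ, φ x * Real.exp (-x ^ 2 / 2))
        * ((2 * Real.pi) ^ (-(((n + 1 : ℕ) : ℝ) / 2)) * √(2 * Real.pi) ^ n) := by
  have := measurable_normalGen (n + 1)
  rw [genMeasure, integral_sphericalMeasure (by fun_prop) (fun r _ => normalGen_nonneg _ _),
    integral_normalGen_fun_fst]

theorem integral_normal_one_pos (n : ℕ) : 0 < ∫ _, (1 : ℝ) ∂genMeasure n (normalGen (n + 1)) := by
  rw [integral_normal_fun_fst n fun _ => 1]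
  simp only [one_mul, integral_exp_neg_half_sq]
  positivity

/-- The mean absolute value of a standard normal variable: the source of √(2/π). -/
theorem integral_normal_abs_inner (n : ℕ) :
    ∫ w, |⟪firstAxis n, w⟫| ∂genMeasure n (normalGen (n + 1))
      = √(2 / Real.pi) * ∫ _, (1 : ℝ) ∂genMeasure n (normalGen (n + 1)) := by
  simp only [inner_firstAxis]
  rw [integral_normal_fun_fst n fun x => |x|, integral_normal_fun_fst n fun _ => 1]
  simp only [one_mul, integral_exp_neg_half_sq, integral_abs_mul_exp_neg_half_sq]
  have h : √(2 / Real.pi) * √(2 * Real.pi) = 2 := by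
    rw [← Real.sqrt_mul (by positivity),
      show 2 / Real.pi * (2 * Real.pi) = 2 ^ 2 by field_simp, Real.sqrt_sq (by norm_num)]
  rw [← mul_assoc _ √(2 * Real.pi), h]

theorem integral_normal_inner_sq (n : ℕ) :
    ∫ w, ⟪firstAxis n, w⟫ ^ 2 ∂genMeasure n (normalGen (n + 1))
      = ∫ _, (1 : ℝ) ∂genMeasure n (normalGen (n + 1)) := by
  simp only [inner_firstAxis]
  rw [integral_normal_fun_fst n fun x => x ^ 2, integral_normal_fun_fst n fun _ => 1]
  simp only [one_mul, integral_exp_neg_half_sq, integral_sq_mul_exp_neg_half_sq]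

theorem normConst_nonneg (m : ℕ) {g : ℝ → ℝ} (hg0 : ∀ u, 0 ≤ u → 0 ≤ g u) :
    0 ≤ normConst m g := by
  refine div_nonneg (Real.Gamma_nonneg_of_nonneg (by positivity)) (mul_nonneg (by positivity) ?_)
  exact setIntegral_nonneg measurableSet_Ioi fun u hu =>
    mul_nonneg (Real.rpow_nonneg (le_of_lt hu) _) (hg0 u (le_of_lt hu))

/-- Moments of a radial variable in terms of the unnormalized radial moments. -/
theorem exists_const_radialLaw {T : Type*} [MeasurableSpace T] {Q : Measure T}
    [IsProbabilityMeasure Q] {n : ℕ} {g : ℝ → ℝ} (hg : Measurable g)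
    (hg0 : ∀ u, 0 ≤ u → 0 ≤ g u) {R : T → ℝ} (hR : HasLaw R (radialLaw n g) Q) :
    ∃ c : ℝ, c * radialMoment n g 0 = 1 ∧ (∀ d, ∫ t, R t ^ d ∂Q = c * radialMoment n g d) ∧
      ∀ d, Integrable (fun t => R t ^ d) Q →
        IntegrableOn (fun r => r ^ n * (r ^ d * g (r ^ 2))) (Set.Ioi 0) := by
  set c := normConst (n + 1) g *
    (2 * Real.pi ^ (((n : ℝ) + 1) / 2) / Real.Gamma (((n : ℝ) + 1) / 2)) with hc
  have hc0 : 0 ≤ c := by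
    have := Real.Gamma_nonneg_of_nonneg (s := ((n : ℝ) + 1) / 2) (by positivity)
    have := normConst_nonneg (n + 1) hg0
    positivity
  have hdens : ∀ d : ℕ, ∀ᵐ r ∂(volume.restrict (Set.Ioi (0 : ℝ))),
      (ENNReal.ofReal (c * r ^ n * g (r ^ 2))).toReal • r ^ d
        = c * (r ^ n * (r ^ d * g (r ^ 2))) := fun d => by
    filter_upwards [ae_restrict_mem measurableSet_Ioi] with r hr
    have hr' : (0 : ℝ) ≤ r := le_of_lt hr
    have := hg0 (r ^ 2) (sq_nonneg r)
    rw [ENNReal.toReal_ofReal (by positivity), smul_eq_mul]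
    ring
  have hmom : ∀ d, ∫ t, R t ^ d ∂Q = c * radialMoment n g d := fun d => by
    have h1 : ∫ t, R t ^ d ∂Q = ∫ r, r ^ d ∂radialLaw n g :=
      hR.integral_comp (f := fun r => r ^ d) (by fun_prop)
    rw [h1, radialLaw, integral_withDensity_eq_integral_toReal_smul (by fun_prop) (by simp),
      integral_congr_ae (hdens d), integral_const_mul, radialMoment]
  -- The zeroth moment of a probability law is 1; this replaces any evaluation of the Gamma and π
  -- factors in c.
  have h0 : c * radialMoment n g 0 = 1 := by
    rw [← hmom 0]; simp
  refine ⟨c, h0, hmom, fun d hd => ?_⟩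
  have hcne : c ≠ 0 := left_ne_zero_of_mul_eq_one h0
  have h1 : Integrable (fun r => r ^ d) (radialLaw n g) := by
    rw [← hR.map_eq]
    exact (integrable_map_measure (by fun_prop) hR.aemeasurable).2 hd
  rw [radialLaw, integrable_withDensity_iff_integrable_smul' (by fun_prop) (by simp)] at h1
  exact (integrable_const_mul_iff (IsUnit.mk0 c hcne) _).1 (h1.congr (hdens d))

end Moments

/-! ### Transfer of moment identities from the normal generator to a general one. -/

section Ratios

open scoped RealInnerProductSpace

variable {T T' : Type*} [MeasurableSpace T] [MeasurableSpace T'] {Q : Measure T}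
  [IsProbabilityMeasure Q] {Q' : Measure T'} [IsProbabilityMeasure Q'] {n : ℕ} {g : ℝ → ℝ}
  {Ry : T → ℝ} {Rx : T' → ℝ}

/-- If a homogeneous function `k` satisfies a moment identity for the normal generator, then it does
so for every generator, up to the ratio of the radial moments. -/
theorem integral_genMeasure_eq_ratio (hg : Measurable g) (hg0 : ∀ u, 0 ≤ u → 0 ≤ g u)
    (hRy : HasLaw Ry (radialLaw n g) Q)
    (hRx : HasLaw Rx (radialLaw n (normalGen (n + 1))) Q') {d : ℕ}
    {k : EuclideanSpace ℝ (Fin (n + 1)) → ℝ}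
    (hk : ∀ r : ℝ, 0 < r → ∀ w, k (r • w) = r ^ d * k w) {s : ℝ} (hs : s ≠ 0)
    (hks : ∫ w, k w ∂genMeasure n (normalGen (n + 1))
      = s * ∫ _, (1 : ℝ) ∂genMeasure n (normalGen (n + 1))) :
    ∫ w, k w ∂genMeasure n g
      = s * ((∫ t, Ry t ^ d ∂Q) / ∫ t, Rx t ^ d ∂Q') * ∫ _, (1 : ℝ) ∂genMeasure n g := by
  obtain ⟨c, hc, hcm, -⟩ := exists_const_radialLaw hg hg0 hRy
  obtain ⟨c', hc', hcm', -⟩ := exists_const_radialLaw (measurable_normalGen _)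
    (fun u _ => normalGen_nonneg _ u) hRx
  have hone : ∀ r : ℝ, 0 < r → ∀ w : EuclideanSpace ℝ (Fin (n + 1)),
      (fun _ => (1 : ℝ)) (r • w) = r ^ 0 * (fun _ => (1 : ℝ)) w := by simp
  have hpos := integral_normal_one_pos n
  rw [integral_genMeasure_of_homogeneous (measurable_normalGen _)
    (fun u _ => normalGen_nonneg _ u) hk, integral_genMeasure_of_homogeneous
    (measurable_normalGen _) (fun u _ => normalGen_nonneg _ u) hone] at hks
  rw [integral_genMeasure_of_homogeneous
    (measurable_normalGen _) (fun u _ => normalGen_nonneg _ u) hone] at hpos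
  rw [integral_genMeasure_of_homogeneous hg hg0 hk, integral_genMeasure_of_homogeneous hg hg0 hone,
    hcm, hcm']
  set K := ∫ θ, k θ.1 ∂(volume : Measure (EuclideanSpace ℝ (Fin (n + 1)))).toSphere
  set S := ∫ _, (1 : ℝ) ∂(volume : Measure (EuclideanSpace ℝ (Fin (n + 1)))).toSphere
  -- If this moment vanished, `hks` would equate 0 with s times a positive total mass.
  have hN : radialMoment n (normalGen (n + 1)) d ≠ 0 := fun h => by
    rw [h, mul_zero] at hks
    exact mul_ne_zero hs hpos.ne' hks.symm
  have hc'0 : c' ≠ 0 := left_ne_zero_of_mul_eq_one hc'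
  rw [show s * (c * radialMoment n g d / (c' * radialMoment n (normalGen (n + 1)) d))
      * (S * radialMoment n g 0)
      = s * radialMoment n g d * S * (c * radialMoment n g 0)
        / (c' * radialMoment n (normalGen (n + 1)) d) by ring, hc, eq_div_iff (mul_ne_zero hc'0 hN)]
  -- With N_d the normal radial moments, `hks` reads K N_d = s S N_0, and c' N_0 = 1 removes N_0.
  -- The sphere integral K is never computed.
  linear_combination (c' * radialMoment n g d) * hks + (s * S * radialMoment n g d) * hc'

theorem integral_abs_inner_genMeasure (hg : Measurable g) (hg0 : ∀ u, 0 ≤ u → 0 ≤ g u)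
    (hRy : HasLaw Ry (radialLaw n g) Q)
    (hRx : HasLaw Rx (radialLaw n (normalGen (n + 1))) Q') :
    ∫ w, |⟪firstAxis n, w⟫| ∂genMeasure n g
      = √(2 / Real.pi) * ((∫ t, Ry t ∂Q) / ∫ t, Rx t ∂Q') * ∫ _, (1 : ℝ) ∂genMeasure n g := by
  simpa only [pow_one] using integral_genMeasure_eq_ratio hg hg0 hRy hRx (d := 1)
    (k := fun w => |⟪firstAxis n, w⟫|)
    (fun r hr w => by rw [inner_smul_right, abs_mul, abs_of_pos hr, pow_one])
    (by positivity) (integral_normal_abs_inner n)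

theorem integral_inner_sq_genMeasure (hg : Measurable g) (hg0 : ∀ u, 0 ≤ u → 0 ≤ g u)
    (hRy : HasLaw Ry (radialLaw n g) Q)
    (hRx : HasLaw Rx (radialLaw n (normalGen (n + 1))) Q') :
    ∫ w, ⟪firstAxis n, w⟫ ^ 2 ∂genMeasure n g
      = ((∫ t, Ry t ^ 2 ∂Q) / ∫ t, Rx t ^ 2 ∂Q') * ∫ _, (1 : ℝ) ∂genMeasure n g := by
  have := integral_genMeasure_eq_ratio hg hg0 hRy hRx (d := 2)
    (k := fun w => ⟪firstAxis n, w⟫ ^ 2) (s := 1)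
    (fun r _ w => by rw [inner_smul_right, mul_pow])
    one_ne_zero (by rw [one_mul]; exact integral_normal_inner_sq n)
  rwa [one_mul] at this

theorem integrable_norm_pow_genMeasure (hg : Measurable g) (hg0 : ∀ u, 0 ≤ u → 0 ≤ g u)
    (hRy : HasLaw Ry (radialLaw n g) Q) {d : ℕ} (h : Integrable (fun t => Ry t ^ d) Q) :
    Integrable (fun w => ‖w‖ ^ d) (genMeasure n g) := by
  obtain ⟨_, _, _, hint⟩ := exists_const_radialLaw hg hg0 hRy
  exact integrable_norm_pow_sphericalMeasure (by fun_prop) (fun r _ => hg0 _ (sq_nonneg r)) d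
    (by simpa using hint d h)

/-- This is the case d = 0 of the preceding moment bound. -/
theorem isFiniteMeasure_genMeasure (hg : Measurable g) (hg0 : ∀ u, 0 ≤ u → 0 ≤ g u)
    (hRy : HasLaw Ry (radialLaw n g) Q) : IsFiniteMeasure (genMeasure n g) := by
  have := integrable_norm_pow_genMeasure hg hg0 hRy (d := 0) (by simp)
  simpa [integrable_const_iff] using this

end Ratios

/-! ### The skew-elliptical law as an affine image of a spherical measure on a half space. -/

section Law

open scoped RealInnerProductSpace ENNReal

/-- The substitution r = t² absorbs the weight r^(-1/2): passing to the marginal generator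
integrates out one coordinate. -/
theorem marginalGen_eq_integral (g : ℝ → ℝ) (q : ℝ) :
    marginalGen g q = ∫ t : ℝ, g (t ^ 2 + q) := by
  have h1 := integral_comp_abs (f := fun t => g (t ^ 2 + q))
  simp only [sq_abs] at h1
  rw [h1, ← integral_comp_rpow_Ioi_of_pos (g := fun t => g (t ^ 2 + q)) (p := 1 / 2) (by norm_num),
    ← integral_const_mul, marginalGen]
  refine setIntegral_congr_fun measurableSet_Ioi fun r hr => ?_
  have hr' : (0 : ℝ) ≤ r := le_of_lt hr
  simp only [smul_eq_mul]
  rw [← Real.sqrt_eq_rpow, Real.sq_sqrt hr']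
  norm_num
  ring

theorem normConst_one_condGen {g : ℝ → ℝ} {q : ℝ} (h : marginalGen g q ≠ 0) :
    normConst 1 (condGen g q) = 1 := by
  have hint : ∫ u in Set.Ioi (0 : ℝ), u ^ (((1 : ℕ) : ℝ) / 2 - 1) * condGen g q u = 1 := by
    have : ∀ u : ℝ, u ^ (((1 : ℕ) : ℝ) / 2 - 1) * condGen g q u
        = u ^ (-(1 / 2) : ℝ) * g (u + q) * (marginalGen g q)⁻¹ := fun u => by
      rw [condGen, Nat.cast_one, show (1 : ℝ) / 2 - 1 = -(1 / 2) by norm_num]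
      ring
    simp_rw [this]
    rw [integral_mul_const]
    exact mul_inv_cancel₀ h
  rw [normConst, hint, Nat.cast_one, Real.Gamma_one_half_eq, Real.sqrt_eq_rpow, mul_one,
    div_self (by positivity)]

theorem marginalGen_mul_ecCDF {g : ℝ → ℝ} (hg0 : ∀ u, 0 ≤ u → 0 ≤ g u) {q : ℝ} (hq : 0 ≤ q)
    (hint : Integrable fun t : ℝ => g (t ^ 2 + q)) (z : ℝ) :
    marginalGen g q * ecCDF (condGen g q) z = ∫ t in Set.Iic z, g (t ^ 2 + q) := by
  have hnn : ∀ t : ℝ, 0 ≤ g (t ^ 2 + q) := fun t => hg0 _ (by positivity)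
  -- When the denominator of `condGen` vanishes, both sides are zero: a nonnegative integrable
  -- function with zero integral is zero almost everywhere. Integrability excludes an integral that
  -- is zero only by convention.
  by_cases h : marginalGen g q = 0
  · rw [h, zero_mul]
    rw [marginalGen_eq_integral, integral_eq_zero_iff_of_nonneg hnn hint] at h
    rw [integral_eq_zero_of_ae (ae_restrict_of_ae h)]
  · rw [ecCDF, ← integral_const_mul]
    refine integral_congr_ae (.of_forall fun t => ?_)
    have : mahalanobis (0 : Fin 1 → ℝ) 1 (fun _ => t) = t ^ 2 := by
      simp [mahalanobis, dotProduct, sq]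
    simp only [ecDensity, normConst_one_condGen h, this, condGen, det_one, Real.sqrt_one]
    field_simp

/-- The point of `ℝ^(n+1)` with first coordinate `t` and remaining coordinates `u`. -/
def consPoint {n : ℕ} (t : ℝ) (u : Fin n → ℝ) : EuclideanSpace ℝ (Fin (n + 1)) :=
  WithLp.toLp 2 (Fin.cons t u)

@[simp] theorem consPoint_zero {n : ℕ} (t : ℝ) (u : Fin n → ℝ) : consPoint t u 0 = t := rfl

@[simp] theorem consPoint_succ {n : ℕ} (t : ℝ) (u : Fin n → ℝ) (i : Fin n) :
    consPoint t u i.succ = u i := rfl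

theorem norm_consPoint_sq {n : ℕ} (t : ℝ) (u : Fin n → ℝ) :
    ‖consPoint t u‖ ^ 2 = t ^ 2 + u ⬝ᵥ u := by
  rw [EuclideanSpace.norm_sq_eq, Fin.sum_univ_succ]
  simp [dotProduct, sq]

theorem inner_consPoint {n : ℕ} (s t : ℝ) (v u : Fin n → ℝ) :
    ⟪consPoint s v, consPoint t u⟫ = s * t + v ⬝ᵥ u := by
  rw [PiLp.inner_apply, Fin.sum_univ_succ]
  simp [dotProduct, mul_comm]

/-- The coordinates of `w` other than the first one. -/
def tailPoint {n : ℕ} (w : EuclideanSpace ℝ (Fin (n + 1))) : Fin n → ℝ := fun i => w i.succ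

theorem measurable_tailPoint {n : ℕ} : Measurable (tailPoint (n := n)) := by
  unfold tailPoint; fun_prop

theorem lintegral_eq_lintegral_consPoint {n : ℕ} {F : EuclideanSpace ℝ (Fin (n + 1)) → ℝ≥0∞}
    (hF : Measurable F) : ∫⁻ w, F w = ∫⁻ u : Fin n → ℝ, ∫⁻ t : ℝ, F (consPoint t u) := by
  rw [← (PiLp.volume_preserving_toLp (Fin (n + 1))).lintegral_comp hF,
    ← (volume_preserving_piFinSuccAbove (fun _ : Fin (n + 1) => ℝ) 0).symm.lintegral_comp
      (by fun_prop)]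
  have hm : Measurable fun p : ℝ × (Fin n → ℝ) => F (WithLp.toLp 2
      ((MeasurableEquiv.piFinSuccAbove (fun _ : Fin (n + 1) => ℝ) 0).symm p)) := by fun_prop
  refine (lintegral_prod_symm _ hm.aemeasurable).trans ?_
  refine lintegral_congr fun u => lintegral_congr fun t => ?_
  congr 2
  ext i
  refine Fin.cases ?_ (fun i => ?_) i <;> simp [MeasurableEquiv.piFinSuccAbove, Fin.insertNthEquiv]

theorem measurable_consPoint {n : ℕ} :
    Measurable fun p : (Fin n → ℝ) × ℝ => consPoint p.2 p.1 := by
  unfold consPoint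
  refine (WithLp.measurable_toLp 2 _).comp (measurable_pi_iff.2 fun i => ?_)
  refine Fin.cases ?_ (fun i => ?_) i
  · simpa using measurable_snd
  · exact (measurable_pi_apply i).comp measurable_fst

/-- Lebesgue measure is, up to a constant, its image under an invertible affine map. -/
theorem exists_lintegral_affine {n : ℕ} {L : Matrix (Fin n) (Fin n) ℝ} (hL : L.det ≠ 0)
    (μ : Fin n → ℝ) : ∃ c : ℝ≥0∞, ∀ F : (Fin n → ℝ) → ℝ≥0∞,
      ∫⁻ x, F x = c * ∫⁻ u, F (μ + L *ᵥ u) := by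
  have hmap := Real.map_matrix_volume_pi_eq_smul_volume_pi hL
  have hne : ENNReal.ofReal |L.det⁻¹| ≠ 0 := by simpa using hL
  have hmeas : Measurable (toLin' L) := (LinearMap.continuous_of_finiteDimensional _).measurable
  have hemb : MeasurableEmbedding (toLin' L) :=
    hmeas.measurableEmbedding (mulVec_injective_iff_isUnit.2
      ((isUnit_iff_isUnit_det _).2 (isUnit_iff_ne_zero.2 hL)))
  refine ⟨(ENNReal.ofReal |L.det⁻¹|)⁻¹, fun F => ?_⟩
  rw [← lintegral_add_left_eq_self F μ]
  have h : ∫⁻ u, F (μ + L *ᵥ u) = ENNReal.ofReal |L.det⁻¹| * ∫⁻ x, F (μ + x) := by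
    rw [← smul_eq_mul, ← lintegral_smul_measure, ← hmap, hemb.lintegral_map]
    rfl
  rw [h, ← mul_assoc, ENNReal.inv_mul_cancel hne ENNReal.ofReal_ne_top, one_mul]

/-- Any such factor serves: the final formulas see L only through L L' = Ω. -/
theorem exists_mul_transpose_eq {n : ℕ} {Ω : Matrix (Fin n) (Fin n) ℝ} (h : Ω.PosDef) :
    ∃ L : Matrix (Fin n) (Fin n) ℝ, L * Lᵀ = Ω ∧ L.det ≠ 0 := by
  open scoped MatrixOrder in
  obtain ⟨B, hB⟩ := CStarAlgebra.nonneg_iff_eq_star_mul_self.mp h.posSemidef.nonneg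
  have hB' : Bᵀ * Bᵀᵀ = Ω := by
    rw [hB, star_eq_conjTranspose, conjTranspose_eq_transpose_of_trivial, transpose_transpose]
  refine ⟨Bᵀ, hB', fun h0 => h.det_pos.ne' ?_⟩
  rw [← hB', det_mul, h0, zero_mul]

theorem mahalanobis_affine {n : ℕ} {Ω L : Matrix (Fin n) (Fin n) ℝ} (hL : L * Lᵀ = Ω)
    (hdet : L.det ≠ 0) (μ u : Fin n → ℝ) : mahalanobis μ Ω (μ + L *ᵥ u) = u ⬝ᵥ u := by
  have hu : IsUnit L.det := isUnit_iff_ne_zero.2 hdet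
  have : Lᵀ * (Ω⁻¹ * L) = 1 := by
    rw [← hL, Matrix.mul_inv_rev, Matrix.mul_assoc, nonsing_inv_mul _ hu, Matrix.mul_one,
      mul_nonsing_inv _ (by rwa [det_transpose])]
  rw [mahalanobis, add_sub_cancel_left, mulVec_mulVec, ← vecMul_transpose, ← dotProduct_mulVec,
    mulVec_mulVec, this, one_mulVec]

/-- The inner normal of the half space which describes the skewing of `SE_n(μ, L L', α, g)`. -/
def skewNormal {n : ℕ} (Ω L : Matrix (Fin n) (Fin n) ℝ) (α : Fin n → ℝ) :
    EuclideanSpace ℝ (Fin (n + 1)) :=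
  consPoint (-1) (Lᵀ *ᵥ ((scaleMatrix Ω)⁻¹ *ᵥ α))

theorem skewNormal_ne_zero {n : ℕ} (Ω L : Matrix (Fin n) (Fin n) ℝ) (α : Fin n → ℝ) :
    skewNormal Ω L α ≠ 0 := fun h => by
  have := congrArg (fun w : EuclideanSpace ℝ (Fin (n + 1)) => w 0) h
  simp [skewNormal] at this

theorem transpose_scaleMatrix_inv {n : ℕ} (Ω : Matrix (Fin n) (Fin n) ℝ) :
    ((scaleMatrix Ω)⁻¹)ᵀ = (scaleMatrix Ω)⁻¹ := by
  rw [transpose_nonsing_inv, scaleMatrix, diagonal_transpose]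

/-- The first coordinate -1 of the normal turns nonnegativity of the inner product into an upper
bound on t, matching the distribution function in `seDensity`. -/
theorem consPoint_mem_halfSpace_skewNormal {n : ℕ} (Ω L : Matrix (Fin n) (Fin n) ℝ)
    (α : Fin n → ℝ) (t : ℝ) (u : Fin n → ℝ) :
    consPoint t u ∈ halfSpace (skewNormal Ω L α) ↔
      t ≤ α ⬝ᵥ ((scaleMatrix Ω)⁻¹ *ᵥ (L *ᵥ u)) := by
  have h : Lᵀ *ᵥ ((scaleMatrix Ω)⁻¹ *ᵥ α) ⬝ᵥ u = α ⬝ᵥ ((scaleMatrix Ω)⁻¹ *ᵥ (L *ᵥ u)) := by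
    rw [mulVec_transpose, ← dotProduct_mulVec, dotProduct_comm, ← transpose_scaleMatrix_inv,
      mulVec_transpose, dotProduct_comm, ← dotProduct_mulVec, transpose_scaleMatrix_inv]
  change 0 ≤ ⟪skewNormal Ω L α, consPoint t u⟫ ↔ _
  rw [skewNormal, inner_consPoint, h]
  constructor <;> intro h <;> linarith

/-- Tonelli: finite total mass forces almost every slice to be integrable, as
`marginalGen_mul_ecCDF` requires. -/
theorem ae_integrable_slice {n : ℕ} {g : ℝ → ℝ} (hg : Measurable g) (hg0 : ∀ u, 0 ≤ u → 0 ≤ g u)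
    (hfin : IsFiniteMeasure (genMeasure n g)) :
    ∀ᵐ u : Fin n → ℝ, Integrable fun t : ℝ => g (t ^ 2 + u ⬝ᵥ u) := by
  have hF : Measurable fun w : EuclideanSpace ℝ (Fin (n + 1)) => ENNReal.ofReal (g (‖w‖ ^ 2)) := by
    fun_prop
  have h1 : ∫⁻ u : Fin n → ℝ, ∫⁻ t : ℝ, ENNReal.ofReal (g (‖consPoint t u‖ ^ 2)) ≠ ∞ := by
    rw [← lintegral_eq_lintegral_consPoint hF]
    have := hfin.measure_univ_lt_top.ne
    rwa [genMeasure, sphericalMeasure, withDensity_apply _ MeasurableSet.univ,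
      Measure.restrict_univ] at this
  have hm : Measurable fun u : Fin n → ℝ =>
      ∫⁻ t : ℝ, ENNReal.ofReal (g (‖consPoint t u‖ ^ 2)) :=
    (hF.comp measurable_consPoint).lintegral_prod_right'
  filter_upwards [ae_lt_top hm h1] with u hu
  simp only [norm_consPoint_sq] at hu
  have hnn : ∀ t : ℝ, 0 ≤ g (t ^ 2 + u ⬝ᵥ u) := fun t =>
    hg0 _ (add_nonneg (sq_nonneg t) (by simpa using dotProduct_star_self_nonneg u))
  refine ⟨(by fun_prop : Measurable fun t : ℝ => g (t ^ 2 + u ⬝ᵥ u)).aestronglyMeasurable, ?_⟩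
  rwa [hasFiniteIntegral_iff_ofReal (.of_forall hnn)]

/-- The skew-elliptical law is the image of a normalized spherical measure on a half space
of `ℝ^(n+1)`. -/
theorem IsSkewElliptical.exists_map_eq {S : Type*} [MeasurableSpace S] {P : Measure S} {n : ℕ}
    {μ α : Fin n → ℝ} {Ω L : Matrix (Fin n) (Fin n) ℝ} {g : ℝ → ℝ} {Y : S → Fin n → ℝ}
    (hY : IsSkewElliptical Y μ Ω α g P) (hL : L * Lᵀ = Ω) (hdet : L.det ≠ 0)
    (hfin : IsFiniteMeasure (genMeasure n g)) :
    ∃ C : ℝ≥0∞, P.map Y = C • ((genMeasure n g).restrict (halfSpace (skewNormal Ω L α))).map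
      fun w => μ + L *ᵥ tailPoint w := by
  have hg := hY.generator.measurable
  have hg0 := hY.generator.nonneg
  obtain ⟨c, hc⟩ := exists_lintegral_affine hdet μ
  set K : ℝ := 2 * (normConst n (marginalGen g) * (√Ω.det)⁻¹) with hK
  have hK0 : 0 ≤ K := by
    have : 0 ≤ normConst n (marginalGen g) := normConst_nonneg n fun q hq => by
      rw [marginalGen_eq_integral]
      exact integral_nonneg fun t => hg0 _ (by positivity)
    positivity
  set H := halfSpace (skewNormal Ω L α) with hH
  have hHm : MeasurableSet H := measurableSet_halfSpace _
  have hT : Measurable fun w : EuclideanSpace ℝ (Fin (n + 1)) => μ + L *ᵥ tailPoint w := by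
    have := measurable_tailPoint (n := n)
    fun_prop
  -- In the coordinate u, the density of Y is the spherical density on the half space with t
  -- integrated out.
  have hdens : ∀ᵐ u : Fin n → ℝ, ENNReal.ofReal (seDensity μ Ω α g (μ + L *ᵥ u))
      = ENNReal.ofReal K *
        ∫⁻ t, H.indicator (fun w => ENNReal.ofReal (g (‖w‖ ^ 2))) (consPoint t u) := by
    filter_upwards [ae_integrable_slice hg hg0 hfin] with u hu
    have huu : 0 ≤ u ⬝ᵥ u := by simpa using dotProduct_star_self_nonneg u
    set z := α ⬝ᵥ ((scaleMatrix Ω)⁻¹ *ᵥ (L *ᵥ u)) with hz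
    have h1 : seDensity μ Ω α g (μ + L *ᵥ u) = K * ∫ t in Set.Iic z, g (t ^ 2 + u ⬝ᵥ u) := by
      rw [seDensity, ecDensity, mahalanobis_affine hL hdet, add_sub_cancel_left,
        ← marginalGen_mul_ecCDF hg0 huu hu]
      ring
    rw [h1, ENNReal.ofReal_mul hK0, ofReal_integral_eq_lintegral_ofReal hu.integrableOn
      (.of_forall fun t => hg0 _ (by positivity)), ← lintegral_indicator measurableSet_Iic]
    congr 1
    refine lintegral_congr fun t => ?_
    by_cases ht : t ≤ z
    · rw [Set.indicator_of_mem (show t ∈ Set.Iic z from ht), Set.indicator_of_mem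
        ((consPoint_mem_halfSpace_skewNormal Ω L α t u).2 ht), norm_consPoint_sq]
    · rw [Set.indicator_of_notMem (show t ∉ Set.Iic z from ht), Set.indicator_of_notMem
        (fun h => ht ((consPoint_mem_halfSpace_skewNormal Ω L α t u).1 h))]
  refine ⟨c * ENNReal.ofReal K, Measure.ext fun s hs => ?_⟩
  set F : EuclideanSpace ℝ (Fin (n + 1)) → ℝ≥0∞ :=
    H.indicator fun w => ENNReal.ofReal (g (‖w‖ ^ 2)) with hF
  have hFm : Measurable F := Measurable.indicator (by fun_prop) hHm
  set s' : Set (Fin n → ℝ) := (fun u => μ + L *ᵥ u) ⁻¹' s with hs'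
  have hs'm : MeasurableSet s' := (by fun_prop : Measurable fun u => μ + L *ᵥ u) hs
  have hleft : P.map Y s = c * (ENNReal.ofReal K *
      ∫⁻ u, s'.indicator (fun u => ∫⁻ t, F (consPoint t u)) u) := by
    rw [hY.hasLaw.map_eq, withDensity_apply _ hs, ← lintegral_indicator hs, hc]
    congr 1
    have hm : Measurable fun u : Fin n → ℝ => ∫⁻ t : ℝ, F (consPoint t u) :=
      (hFm.comp measurable_consPoint).lintegral_prod_right'
    rw [← lintegral_const_mul _ (hm.indicator hs'm)]
    refine lintegral_congr_ae ?_
    filter_upwards [hdens] with u hu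
    by_cases h : u ∈ s'
    · rw [Set.indicator_of_mem h, Set.indicator_of_mem (show μ + L *ᵥ u ∈ s from h), hu]
    · rw [Set.indicator_of_notMem h, Set.indicator_of_notMem (show μ + L *ᵥ u ∉ s from h), mul_zero]
  have hright : ((genMeasure n g).restrict H).map (fun w => μ + L *ᵥ tailPoint w) s
      = ∫⁻ u, s'.indicator (fun u => ∫⁻ t, F (consPoint t u)) u := by
    have hpre : MeasurableSet (tailPoint ⁻¹' s' : Set (EuclideanSpace ℝ (Fin (n + 1)))) :=
      measurable_tailPoint hs'm
    rw [Measure.map_apply hT hs]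
    change ((genMeasure n g).restrict H) (tailPoint ⁻¹' s') = _
    rw [Measure.restrict_apply hpre, genMeasure, sphericalMeasure,
      withDensity_apply _ (hpre.inter hHm), ← lintegral_indicator (hpre.inter hHm),
      ← Set.indicator_indicator, lintegral_eq_lintegral_consPoint (hFm.indicator hpre)]
    refine lintegral_congr fun u => ?_
    by_cases h : u ∈ s'
    · rw [Set.indicator_of_mem h]
      refine lintegral_congr fun t => ?_
      rw [Set.indicator_of_mem (show consPoint t u ∈ tailPoint ⁻¹' s' from h)]
    · rw [Set.indicator_of_notMem h]
      refine (lintegral_congr fun t => ?_).trans lintegral_zero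
      rw [Set.indicator_of_notMem (show consPoint t u ∉ tailPoint ⁻¹' s' from h)]
  rw [hleft, Measure.smul_apply, hright, smul_eq_mul, mul_assoc]

end Law

/-! ### Moments of quadratic forms as traces. -/

section TraceMoments

variable {S : Type*} [MeasurableSpace S] {P : Measure S} {n : ℕ} {Y : S → Fin n → ℝ}

theorem integral_trace_mul {ι : Type*} [Fintype ι] (N : Matrix ι ι ℝ) {X : S → Matrix ι ι ℝ}
    (hX : ∀ i j, Integrable (fun s => X s i j) P) :
    ∫ s, (N * X s).trace ∂P = (N * Matrix.of fun i j => ∫ s, X s i j ∂P).trace := by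
  have htr : ∀ M : Matrix ι ι ℝ, (N * M).trace = ∑ i, ∑ j, N i j * M j i := fun M => by
    simp [trace, mul_apply]
  simp only [htr, of_apply]
  have hint : ∀ i j, Integrable (fun s => N i j * X s j i) P := fun i j => (hX j i).const_mul _
  refine (integral_finsetSum _ fun i _ => integrable_finsetSum _ fun j _ => hint i j).trans ?_
  refine Finset.sum_congr rfl fun i _ => (integral_finsetSum _ fun j _ => hint i j).trans ?_
  exact Finset.sum_congr rfl fun j _ => integral_const_mul _ _

theorem trace_mul_vecMulVec' (A : Matrix (Fin n) (Fin n) ℝ) (a b : Fin n → ℝ) :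
    (A * vecMulVec a b).trace = b ⬝ᵥ (A *ᵥ a) := by
  rw [mul_vecMulVec, trace_vecMulVec, dotProduct_comm]

theorem quadForm_eq_sum (A : Matrix (Fin n) (Fin n) ℝ) (y : Fin n → ℝ) :
    quadForm A y = ∑ i, ∑ j, A i j * (y i * y j) := by
  simp only [quadForm, dotProduct, mulVec, Finset.mul_sum]
  exact Finset.sum_congr rfl fun i _ => Finset.sum_congr rfl fun j _ => by ring

theorem integral_quadForm (h : ∀ i j, Integrable (fun s => Y s i * Y s j) P)
    (A : Matrix (Fin n) (Fin n) ℝ) :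
    ∫ s, quadForm A (Y s) ∂P = (A * M2 Y P).trace := by
  rw [M2, ← integral_trace_mul A (X := fun s => vecMulVec (Y s) (Y s)) h]
  simp only [trace_mul_vecMulVec', quadForm]

theorem integrable_quadForm (h : ∀ i j, Integrable (fun s => Y s i * Y s j) P)
    (A : Matrix (Fin n) (Fin n) ℝ) : Integrable (fun s => quadForm A (Y s)) P := by
  simp only [quadForm_eq_sum]
  exact integrable_finsetSum _ fun i _ => integrable_finsetSum _ fun j _ => (h i j).const_mul _

/-- Pointwise, y'Ay · y'By = tr(A yy') tr(B yy') = tr((A ⊗ B)(yy' ⊗ yy')), which is linear in the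
entries of yy' ⊗ yy'. -/
theorem integral_quadForm_mul_quadForm
    (h : ∀ i j k l, Integrable (fun s => Y s i * Y s j * Y s k * Y s l) P)
    (A B : Matrix (Fin n) (Fin n) ℝ) :
    ∫ s, quadForm A (Y s) * quadForm B (Y s) ∂P = ((A ⊗ₖ B) * M4 Y P).trace := by
  rw [M4, ← integral_trace_mul (A ⊗ₖ B)
    (X := fun s => vecMulVec (Y s) (Y s) ⊗ₖ vecMulVec (Y s) (Y s)) fun p q => ?_]
  · simp only [← mul_kronecker_mul, trace_kronecker, trace_mul_vecMulVec', quadForm]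
  · simpa only [kroneckerMap_apply, vecMulVec_apply, mul_assoc] using h p.1 q.1 p.2 q.2

theorem memLp_mul_of_integrable (hY : AEMeasurable Y P)
    (h : ∀ i j k l, Integrable (fun s => Y s i * Y s j * Y s k * Y s l) P) (i j : Fin n) :
    MemLp (fun s => Y s i * Y s j) 2 P := by
  have hm : AEMeasurable (fun s => Y s i * Y s j) P := by fun_prop
  refine (memLp_two_iff_integrable_sq hm.aestronglyMeasurable).2 ((h i j i j).congr
    (.of_forall fun s => ?_))
  simp only
  ring

theorem memLp_quadForm (hY : AEMeasurable Y P)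
    (h : ∀ i j k l, Integrable (fun s => Y s i * Y s j * Y s k * Y s l) P)
    (A : Matrix (Fin n) (Fin n) ℝ) : MemLp (fun s => quadForm A (Y s)) 2 P := by
  simp only [quadForm_eq_sum]
  exact memLp_finsetSum _ fun i _ => memLp_finsetSum _ fun j _ =>
    (memLp_mul_of_integrable hY h i j).const_mul _

theorem covariance_quadForm [IsProbabilityMeasure P] (hY : AEMeasurable Y P)
    (h : ∀ i j k l, Integrable (fun s => Y s i * Y s j * Y s k * Y s l) P)
    (A B : Matrix (Fin n) (Fin n) ℝ) :
    cov[fun s => quadForm A (Y s), fun s => quadForm B (Y s); P]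
      = ((A ⊗ₖ B) * M4 Y P).trace - (A * M2 Y P).trace * (B * M2 Y P).trace := by
  have h2 : ∀ i j, Integrable (fun s => Y s i * Y s j) P := fun i j =>
    (memLp_mul_of_integrable hY h i j).integrable (by norm_num)
  rw [covariance_eq_sub (memLp_quadForm hY h A) (memLp_quadForm hY h B),
    integral_quadForm h2, integral_quadForm h2, ← integral_quadForm_mul_quadForm h]
  rfl

end TraceMoments

/-! ### Moments of skew-elliptical vectors. -/

section SkewMoments

open scoped RealInnerProductSpace ENNReal

variable {S T T' : Type*} [MeasurableSpace S] [MeasurableSpace T] [MeasurableSpace T']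
  {P : Measure S} [IsProbabilityMeasure P] {Q : Measure T} [IsProbabilityMeasure Q]
  {Q' : Measure T'} [IsProbabilityMeasure Q'] {n : ℕ} {g : ℝ → ℝ} {Ry : T → ℝ} {Rx : T' → ℝ}
  {μ α : Fin n → ℝ} {Ω L : Matrix (Fin n) (Fin n) ℝ} {Y : S → Fin n → ℝ}

theorem scaleMatrix_mul_inv (hΩ : Ω.PosDef) : scaleMatrix Ω * (scaleMatrix Ω)⁻¹ = 1 := by
  refine mul_nonsing_inv _ (isUnit_iff_ne_zero.2 ?_)
  rw [scaleMatrix, det_diagonal]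
  exact Finset.prod_ne_zero_iff.2 fun i _ => (Real.sqrt_pos.2 hΩ.diag_pos).ne'

/-- The row `i` of the affine map as a vector of `ℝ^(n+1)`. -/
def rowPoint (L : Matrix (Fin n) (Fin n) ℝ) (i : Fin n) : EuclideanSpace ℝ (Fin (n + 1)) :=
  consPoint 0 (L i)

/-- Coordinates of L u become linear functionals on ℝ^(n+1), to which the spherical results apply.
-/
theorem mulVec_tailPoint (L : Matrix (Fin n) (Fin n) ℝ) (w : EuclideanSpace ℝ (Fin (n + 1)))
    (i : Fin n) : (L *ᵥ tailPoint w) i = ⟪rowPoint L i, w⟫ := by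
  have : w = consPoint (w 0) (tailPoint w) := by
    ext j; refine Fin.cases ?_ (fun j => ?_) j <;> rfl
  conv_rhs => rw [this, rowPoint, inner_consPoint, zero_mul, zero_add]
  rfl

theorem inner_rowPoint (hL : L * Lᵀ = Ω) (i j : Fin n) : ⟪rowPoint L i, rowPoint L j⟫ = Ω i j := by
  rw [rowPoint, rowPoint, inner_consPoint, ← hL, mul_apply']
  simp

/-- With b the normal, the numerator is (L L'ω⁻¹α)_i = (ω Ω̄ α)_i and ‖b‖² = 1 + α'Ω̄α, so the
quotient is (ω δ)_i. -/
theorem inner_rowPoint_skewNormal (hΩ : Ω.PosDef) (hL : L * Lᵀ = Ω) (i : Fin n) :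
    ⟪rowPoint L i, skewNormal Ω L α⟫ / ‖skewNormal Ω L α‖ = skewDeltaW Ω α i := by
  have hmul : ∀ v, Ω *ᵥ v = L *ᵥ (Lᵀ *ᵥ v) := fun v => by rw [mulVec_mulVec, hL]
  have hinner : ⟪rowPoint L i, skewNormal Ω L α⟫ = (Ω *ᵥ ((scaleMatrix Ω)⁻¹ *ᵥ α)) i := by
    rw [rowPoint, skewNormal, inner_consPoint, zero_mul, zero_add]
    exact (congrFun (hmul _) i).symm
  have hnorm : ‖skewNormal Ω L α‖ = √(1 + α ⬝ᵥ (corrMatrix Ω *ᵥ α)) := by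
    rw [← Real.sqrt_sq (norm_nonneg _), skewNormal, norm_consPoint_sq]
    congr 2
    · norm_num
    · rw [corrMatrix, ← mulVec_mulVec, ← mulVec_mulVec]
      rw [dotProduct_mulVec α, ← mulVec_transpose, transpose_scaleMatrix_inv, hmul,
        dotProduct_mulVec _ L, ← mulVec_transpose]
  have hω : scaleMatrix Ω *ᵥ (corrMatrix Ω *ᵥ α) = Ω *ᵥ ((scaleMatrix Ω)⁻¹ *ᵥ α) := by
    rw [mulVec_mulVec, corrMatrix, ← Matrix.mul_assoc, ← Matrix.mul_assoc, scaleMatrix_mul_inv hΩ,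
      Matrix.one_mul, mulVec_mulVec]
  rw [hinner, hnorm, skewDeltaW, skewDelta, mulVec_smul, hω, Pi.smul_apply, smul_eq_mul,
    div_eq_inv_mul]

/-- Expectations under a skew-elliptical law as half-space integrals. -/
theorem IsSkewElliptical.exists_integral_eq (hY : IsSkewElliptical Y μ Ω α g P)
    (hL : L * Lᵀ = Ω) (hdet : L.det ≠ 0) (hfin : IsFiniteMeasure (genMeasure n g)) :
    ∃ C : ℝ, ∀ h : (Fin n → ℝ) → ℝ, Measurable h →
      (Integrable (fun w => h (μ + L *ᵥ tailPoint w)) (genMeasure n g) →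
        Integrable (fun s => h (Y s)) P) ∧
      ∫ s, h (Y s) ∂P
        = C * ∫ w in halfSpace (skewNormal Ω L α), h (μ + L *ᵥ tailPoint w) ∂genMeasure n g := by
  obtain ⟨C, hC⟩ := hY.exists_map_eq hL hdet hfin
  have hm : AEMeasurable Y P := hY.hasLaw.aemeasurable
  have hT : Measurable fun w : EuclideanSpace ℝ (Fin (n + 1)) => μ + L *ᵥ tailPoint w := by
    have := measurable_tailPoint (n := n)
    fun_prop
  -- An infinite factor would give total mass 0 or ∞ instead of 1.
  have hCtop : C ≠ ∞ := by
    rintro rfl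
    have h1 := congrArg (fun m => m Set.univ) hC
    simp only [Measure.map_apply_of_aemeasurable hm MeasurableSet.univ, Set.preimage_univ,
      measure_univ, Measure.smul_apply, smul_eq_mul, ENNReal.top_mul'] at h1
    split_ifs at h1 <;> simp at h1
  refine ⟨C.toReal, fun h hh => ⟨fun hi => ?_, ?_⟩⟩
  · have : Integrable h (P.map Y) := by
      rw [hC]
      exact ((integrable_map_measure hh.aestronglyMeasurable hT.aemeasurable).2
        hi.integrableOn).smul_measure hCtop
    exact (integrable_map_measure hh.aestronglyMeasurable hm).1 this
  · rw [← integral_map hm hh.aestronglyMeasurable, hC, integral_smul_measure,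
      integral_map hT.aemeasurable hh.aestronglyMeasurable, smul_eq_mul]

theorem exists_norm_affine_le (μ : Fin n → ℝ) (L : Matrix (Fin n) (Fin n) ℝ) :
    ∃ K : ℝ, 0 ≤ K ∧ ∀ w i, |(μ + L *ᵥ tailPoint w) i| ≤ K * (1 + ‖w‖) := by
  have hK : ∀ i, |μ i| + ‖rowPoint L i‖ ≤ ∑ i, (|μ i| + ‖rowPoint L i‖) := fun i =>
    Finset.single_le_sum (f := fun i => |μ i| + ‖rowPoint L i‖) (fun _ _ => by positivity)
      (Finset.mem_univ i)
  refine ⟨∑ i, (|μ i| + ‖rowPoint L i‖), Finset.sum_nonneg fun _ _ => by positivity,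
    fun w i => ?_⟩
  rw [Pi.add_apply, mulVec_tailPoint]
  calc |μ i + ⟪rowPoint L i, w⟫| ≤ |μ i| + ‖rowPoint L i‖ * ‖w‖ :=
        (abs_add_le _ _).trans (add_le_add le_rfl (abs_real_inner_le_norm _ _))
    _ ≤ (|μ i| + ‖rowPoint L i‖) * (1 + ‖w‖) := by
        nlinarith [mul_nonneg (abs_nonneg (μ i)) (norm_nonneg w), norm_nonneg (rowPoint L i)]
    _ ≤ _ := by gcongr; exact hK i

theorem integrable_of_le_one_add_norm_pow {m : Measure (EuclideanSpace ℝ (Fin (n + 1)))}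
    [IsFiniteMeasure m] {d : ℕ} (h : Integrable (fun w => ‖w‖ ^ d) m)
    {k : EuclideanSpace ℝ (Fin (n + 1)) → ℝ} (hk : Measurable k) {K : ℝ} (hK : 0 ≤ K)
    (hle : ∀ w, |k w| ≤ K * (1 + ‖w‖) ^ d) : Integrable k m := by
  -- The dominating function comes from (1 + r)^d ≤ 2^(d-1) (1 + r^d); for d = 0 the truncated
  -- exponent gives the factor 1.
  refine ((((integrable_const (1 : ℝ)).add h).const_mul (2 ^ (d - 1))).const_mul K).mono'
    hk.aestronglyMeasurable (.of_forall fun w => (hle w).trans ?_)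
  gcongr
  simpa using add_pow_le zero_le_one (norm_nonneg w) d

theorem IsSkewElliptical.integrable_mul (hY : IsSkewElliptical Y μ Ω α g P)
    (hRy : HasLaw Ry (radialLaw n g) Q) (h : Integrable (fun t => Ry t ^ 2) Q) (i j : Fin n) :
    Integrable (fun s => Y s i * Y s j) P := by
  have hfin := isFiniteMeasure_genMeasure hY.generator.measurable hY.generator.nonneg hRy
  obtain ⟨L, hL, hdet⟩ := exists_mul_transpose_eq hY.posDef
  obtain ⟨C, hC⟩ := hY.exists_integral_eq hL hdet hfin
  obtain ⟨K, hK, hle⟩ := exists_norm_affine_le μ L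
  have := measurable_tailPoint (n := n)
  refine (hC (fun y => y i * y j) (by fun_prop)).1 (integrable_of_le_one_add_norm_pow
    (integrable_norm_pow_genMeasure hY.generator.measurable hY.generator.nonneg hRy h)
    (by fun_prop) (K := K ^ 2) (by positivity) fun w => ?_)
  rw [abs_mul]
  calc _ ≤ (K * (1 + ‖w‖)) * (K * (1 + ‖w‖)) := by gcongr <;> exact hle _ _
    _ = _ := by ring

theorem IsSkewElliptical.integrable_mul_mul_mul (hY : IsSkewElliptical Y μ Ω α g P)
    (hRy : HasLaw Ry (radialLaw n g) Q) (h : Integrable (fun t => Ry t ^ 4) Q)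
    (i j k l : Fin n) : Integrable (fun s => Y s i * Y s j * Y s k * Y s l) P := by
  have hfin := isFiniteMeasure_genMeasure hY.generator.measurable hY.generator.nonneg hRy
  obtain ⟨L, hL, hdet⟩ := exists_mul_transpose_eq hY.posDef
  obtain ⟨C, hC⟩ := hY.exists_integral_eq hL hdet hfin
  obtain ⟨K, hK, hle⟩ := exists_norm_affine_le μ L
  have := measurable_tailPoint (n := n)
  refine (hC (fun y => y i * y j * y k * y l) (by fun_prop)).1 (integrable_of_le_one_add_norm_pow
    (integrable_norm_pow_genMeasure hY.generator.measurable hY.generator.nonneg hRy h)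
    (by fun_prop) (K := K ^ 4) (by positivity) fun w => ?_)
  rw [abs_mul, abs_mul, abs_mul]
  calc _ ≤ (K * (1 + ‖w‖)) * (K * (1 + ‖w‖)) * (K * (1 + ‖w‖)) * (K * (1 + ‖w‖)) := by
        gcongr <;> exact hle _ _
    _ = _ := by ring

/-- The second moment matrix of a skew-elliptical vector. -/
theorem IsSkewElliptical.M2_eq (hY : IsSkewElliptical Y μ Ω α g P)
    (hRy : HasLaw Ry (radialLaw n g) Q)
    (hRx : HasLaw Rx (radialLaw n (normalGen (n + 1))) Q')
    (h : Integrable (fun t => Ry t ^ 2) Q) :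
    M2 Y P = vecMulVec μ μ
      + (√(2 / Real.pi) * ((∫ t, Ry t ∂Q) / ∫ t, Rx t ∂Q'))
        • (vecMulVec (skewDeltaW Ω α) μ + vecMulVec μ (skewDeltaW Ω α))
      + ((∫ t, Ry t ^ 2 ∂Q) / ∫ t, Rx t ^ 2 ∂Q') • Ω := by
  have hg := hY.generator.measurable
  have hg0 := hY.generator.nonneg
  have hf : Measurable fun r : ℝ => g (r ^ 2) := by fun_prop
  have hfin := isFiniteMeasure_genMeasure hg hg0 hRy
  obtain ⟨L, hL, hdet⟩ := exists_mul_transpose_eq hY.posDef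
  obtain ⟨C, hC⟩ := hY.exists_integral_eq hL hdet hfin
  set b := skewNormal Ω L α with hb
  have hb0 : b ≠ 0 := skewNormal_ne_zero Ω L α
  have hn2 := integrable_norm_pow_genMeasure hg hg0 hRy h
  have hn1 : Integrable (fun w => ‖w‖) (genMeasure n g) := by
    refine ((integrable_const (1 : ℝ)).add hn2).mono' (by fun_prop) (.of_forall fun w => ?_)
    rw [norm_norm, Pi.add_apply]
    nlinarith [sq_nonneg (‖w‖ - 1), norm_nonneg w]
  set I := ∫ _, (1 : ℝ) ∂genMeasure n g with hI
  set r₁ := (∫ t, Ry t ∂Q) / ∫ t, Rx t ∂Q'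
  set r₂ := (∫ t, Ry t ^ 2 ∂Q) / ∫ t, Rx t ^ 2 ∂Q'
  -- The test function 1 determines C: the half space carries half of the total mass I.
  have hCI : C * (I / 2) = 1 := by
    have := (hC (fun _ => 1) measurable_const).2
    rw [setIntegral_halfSpace_of_even hf hb0 (integrable_const 1) (fun _ => rfl)] at this
    rw [hI, ← this]
    simp
  have h1 : ∀ i, C * ∫ w in halfSpace b, ⟪rowPoint L i, w⟫ ∂genMeasure n g
      = √(2 / Real.pi) * r₁ * skewDeltaW Ω α i := fun i => by
    rw [setIntegral_halfSpace_inner hf hn1 hb0 _ (norm_firstAxis n),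
      integral_abs_inner_genMeasure hg hg0 hRy hRx, hb,
      inner_rowPoint_skewNormal hY.posDef hL]
    linear_combination (√(2 / Real.pi) * r₁ * skewDeltaW Ω α i) * hCI
  -- The integrand is even, so the half space, and with it α, drops out.
  have h2 : ∀ i j, C * ∫ w in halfSpace b, ⟪rowPoint L i, w⟫ * ⟪rowPoint L j, w⟫ ∂genMeasure n g
      = r₂ * Ω i j := fun i j => by
    rw [setIntegral_halfSpace_of_even hf hb0 (integrable_inner_mul_inner hn2 _ _) (by simp),
      integral_inner_mul_inner_sphericalMeasure hf hn2 _ _ (norm_firstAxis n),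
      integral_inner_sq_genMeasure hg hg0 hRy hRx, inner_rowPoint hL]
    linear_combination (r₂ * Ω i j) * hCI
  ext i j
  have hexp : ∀ w : EuclideanSpace ℝ (Fin (n + 1)),
      (μ + L *ᵥ tailPoint w) i * (μ + L *ᵥ tailPoint w) j
        = μ i * μ j * 1 + (μ j * ⟪rowPoint L i, w⟫ + μ i * ⟪rowPoint L j, w⟫)
          + ⟪rowPoint L i, w⟫ * ⟪rowPoint L j, w⟫ := fun w => by
    rw [Pi.add_apply, Pi.add_apply, mulVec_tailPoint, mulVec_tailPoint]
    ring
  have hi1 : ∀ (a : ℝ) k, Integrable (fun w => a * ⟪rowPoint L k, w⟫)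
      ((genMeasure n g).restrict (halfSpace b)) :=
    fun a k => ((integrable_inner_of_norm hn1 _).const_mul a).integrableOn
  have hi2 : Integrable (fun w => μ j * ⟪rowPoint L i, w⟫ + μ i * ⟪rowPoint L j, w⟫)
      ((genMeasure n g).restrict (halfSpace b)) := (hi1 _ i).add (hi1 _ j)
  have hi3 : Integrable (fun w => μ i * μ j * 1 +
      (μ j * ⟪rowPoint L i, w⟫ + μ i * ⟪rowPoint L j, w⟫))
      ((genMeasure n g).restrict (halfSpace b)) := (integrable_const _).add hi2
  have hone : C * ∫ _ in halfSpace b, (1 : ℝ) ∂genMeasure n g = 1 := by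
    rw [setIntegral_halfSpace_of_even hf hb0 (integrable_const 1) (fun _ => rfl), hCI]
  have hM : M2 Y P i j = ∫ s, Y s i * Y s j ∂P := rfl
  have hmain := (hC (fun y => y i * y j) (by fun_prop)).2
  simp only [hexp] at hmain
  rw [integral_add hi3 (integrable_inner_mul_inner hn2 _ _).integrableOn,
    integral_add (integrable_const _) hi2, integral_add (hi1 _ i) (hi1 _ j),
    integral_const_mul, integral_const_mul, integral_const_mul] at hmain
  rw [hM, hmain]
  simp only [Matrix.add_apply, Matrix.smul_apply, vecMulVec_apply, smul_eq_mul]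
  linear_combination (μ i * μ j) * hone + μ j * h1 i + μ i * h1 j + h2 i j

/-- Symmetry of A merges the two cross terms, whence the factor 2. -/
theorem trace_mul_M2_eq {A M : Matrix (Fin n) (Fin n) ℝ} (hA : A.IsSymm) {δ : Fin n → ℝ} {a k : ℝ}
    (hM : M = vecMulVec μ μ + a • (vecMulVec δ μ + vecMulVec μ δ) + k • Ω) :
    (A * M).trace = μ ⬝ᵥ (A *ᵥ μ) + 2 * a * (μ ⬝ᵥ (A *ᵥ δ)) + k * (A * Ω).trace := by
  have hswap : δ ⬝ᵥ (A *ᵥ μ) = μ ⬝ᵥ (A *ᵥ δ) := by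
    rw [dotProduct_mulVec, ← mulVec_transpose, hA.eq, dotProduct_comm]
  rw [hM, Matrix.mul_add, Matrix.mul_add, trace_add, trace_add, Matrix.mul_smul, trace_smul,
    Matrix.mul_add, trace_add, trace_mul_vecMulVec', trace_mul_vecMulVec', trace_mul_vecMulVec',
    hswap, Matrix.mul_smul, trace_smul, smul_eq_mul, smul_eq_mul]
  ring

end SkewMoments

end SkewElliptical

end

theorem corollary3p3 {S T T' : Type*} [MeasurableSpace S] [MeasurableSpace T] [MeasurableSpace T']
    (P : Measure S) [IsProbabilityMeasure P]
    (Q : Measure T) [IsProbabilityMeasure Q]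
    (Q' : Measure T') [IsProbabilityMeasure Q']
    {n : ℕ} (hn : 0 < n)
    (μ α : Fin n → ℝ) (Ω : Matrix (Fin n) (Fin n) ℝ) (g : ℝ → ℝ)
    (Y : S → Fin n → ℝ) (hY : SkewElliptical.IsSkewElliptical Y μ Ω α g P)
    (Ry : T → ℝ) (hRy : HasLaw Ry (SkewElliptical.radialLaw n g) Q)
    (Rx : T' → ℝ)
    (hRx : HasLaw Rx (SkewElliptical.radialLaw n (SkewElliptical.normalGen (n + 1))) Q')
    (A B : Matrix (Fin n) (Fin n) ℝ) (hA : A.IsSymm) (hB : B.IsSymm) :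
    (Integrable (fun t => Ry t ^ 2) Q →
      (∀ i j, Integrable (fun s => Y s i * Y s j) P) ∧
      Integrable (fun s => SkewElliptical.quadForm A (Y s)) P ∧
      ∫ s, SkewElliptical.quadForm A (Y s) ∂P = (A * SkewElliptical.M2 Y P).trace ∧
      (A * SkewElliptical.M2 Y P).trace =
        μ ⬝ᵥ (A *ᵥ μ)
          + 2 * Real.sqrt (2 / Real.pi) * ((∫ t, Ry t ∂Q) / ∫ t, Rx t ∂Q')
            * (μ ⬝ᵥ (A *ᵥ SkewElliptical.skewDeltaW Ω α))
          + ((∫ t, Ry t ^ 2 ∂Q) / ∫ t, Rx t ^ 2 ∂Q') * (A * Ω).trace) ∧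
    (Integrable (fun t => Ry t ^ 4) Q →
      (∀ i j k l, Integrable (fun s => Y s i * Y s j * Y s k * Y s l) P) ∧
      MemLp (fun s => SkewElliptical.quadForm A (Y s)) 2 P ∧
      MemLp (fun s => SkewElliptical.quadForm B (Y s)) 2 P ∧
      ∫ s, SkewElliptical.quadForm A (Y s) ^ 2 ∂P
        = ((A ⊗ₖ A) * SkewElliptical.M4 Y P).trace ∧
      Var[fun s => SkewElliptical.quadForm A (Y s); P]
        = ((A ⊗ₖ A) * SkewElliptical.M4 Y P).trace
          - (A * SkewElliptical.M2 Y P).trace ^ 2 ∧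
      cov[fun s => SkewElliptical.quadForm A (Y s), fun s => SkewElliptical.quadForm B (Y s); P]
        = ((A ⊗ₖ B) * SkewElliptical.M4 Y P).trace
          - (A * SkewElliptical.M2 Y P).trace * (B * SkewElliptical.M2 Y P).trace) := by
  refine ⟨fun h => ?_, fun h => ?_⟩
  · have h2 := fun i j => hY.integrable_mul hRy h i j
    refine ⟨h2, SkewElliptical.integrable_quadForm h2 A, SkewElliptical.integral_quadForm h2 A, ?_⟩
    rw [SkewElliptical.trace_mul_M2_eq hA (hY.M2_eq hRy hRx h)]
    ring
  · have h4 := fun i j k l => hY.integrable_mul_mul_mul hRy h i j k l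
    have hm := hY.hasLaw.aemeasurable
    have hcov := SkewElliptical.covariance_quadForm hm h4 A
    refine ⟨h4, SkewElliptical.memLp_quadForm hm h4 A, SkewElliptical.memLp_quadForm hm h4 B,
      ?_, ?_, hcov B⟩
    · rw [← SkewElliptical.integral_quadForm_mul_quadForm h4]
      simp only [sq]
    · rw [← covariance_self (SkewElliptical.memLp_quadForm hm h4 A).aestronglyMeasurable.aemeasurable,
        hcov A, sq]
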